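/- **Theorem.** Every tropical cycle in $\mathbb{R}^n$ is a finite sum of translated fan cycles: if $X$ is a tropical cycle of dimension $d$ in $\mathbb{R}^n$, then there are an integer $l \ge 0$, fan cycles $F_1, \dots, F_l$ of dimension $d$ in $\mathbb{R}^n$ and points $p_1, \dots, p_l \in \mathbb{R}^n$ such that $$X = \sum_{i=1}^{l} (F_i + p_i).$$ Here the following definitions are used. * A rational polyhedron in $\mathbb{R}^n$ is the solution set of finitely many inequalities $\langle a, x\rangle \le b$ with $a \in \mathbb{Z}^n$, $b \in \mathbb{R}$; for a polyhedron $\sigma$, $V_\sigma$ denotes the linear space spanned by the differences of points of $\sigma$, and $\dim\sigma = \dim V_\sigma$. * A tropical polyhedral complex of dimension $d$ is a finite polyhedral complex (possibly empty) of nonempty rational polyhedra, pure of dimension $d$, with integer weights $\omega(\sigma)$ on its $d$-dimensional cells (facets), which is balanced: for each $(d-1)$-dimensional cell $\tau$, $$\sum_{\sigma \supset \tau \text{ facet}} \omega(\sigma)\, v_{\sigma/\tau} = 0 \quad\text{in } \mathbb{R}^n/V_\tau ,$$ where $v_{\sigma/\tau}$ is the primitive generator, with respect to the image of $\mathbb{Z}^n$,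 of the ray obtained by projecting $\sigma$ to $\mathbb{R}^n/V_\tau$ (with the image of $\tau$ as origin). Its support is the union of the facets of nonzero weight. * A tropical cycle of dimension $d$ is an equivalence class of such complexes, two complexes being equivalent if they induce the same weights at generic points, that is, at all points outside a finite union of affine subspaces of dimension less than $d$. (The weight at a generic point is the weight of the facet containing it, or $0$ if there is none.) In other words, up to facets of weight zero, they have a common refinement with the same induced weights. * The sum of cycles of dimension $d$ is given by adding the weights at generic points; the translate $X + p$ has at $x$ the weight of $X$ at $x - p$. The empty sum is the zero cycle. * A fan cycle is a tropical cycle whose support is a union of cones with vertex at $0$. -/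

import Mathlib

namespace Tropical

/-- The ambient space `ℝⁿ`, with the lattice `ℤⁿ` of its integer points. -/
abbrev Space (n : ℕ) : Type := Fin n → ℝ

/-- A rational polyhedron: the solution set of finitely many inequalities `⟨a, x⟩ ≤ b` with
integral normal vector `a` and real right-hand side `b`. -/
def IsRationalPolyhedron {n : ℕ} (σ : Set (Space n)) : Prop :=
  ∃ s : Finset ((Fin n → ℤ) × ℝ), σ = {x | ∀ c ∈ s, ∑ i, (c.1 i : ℝ) * x i ≤ c.2}

/-- `τ` is a (nonempty) face of the polyhedron `σ`: the set of points of `σ` at which some linear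
form attains its maximum over `σ`. The zero form gives the face `σ` itself. -/
def IsFace {n : ℕ} (τ σ : Set (Space n)) : Prop :=
  τ.Nonempty ∧ IsExposed ℝ σ τ

/-- The dimension of `σ`, that is, of the linear space `V_σ` spanned by the differences of points
of `σ`. -/
noncomputable def dim {n : ℕ} (σ : Set (Space n)) : ℕ :=
  Module.finrank ℝ (vectorSpan ℝ σ)

/-- The class in `ℝⁿ / V_τ` of an integer vector. -/
def IsIntegral {n : ℕ} (τ : Set (Space n)) (v : Space n ⧸ vectorSpan ℝ τ) : Prop :=
  ∃ z : Fin n → ℤ, v = Submodule.Quotient.mk (fun i => (z i : ℝ))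

/-- `v` is the primitive integer generator `v_{σ/τ}` of the ray obtained by projecting `σ`
to `ℝⁿ / V_τ` (with the image of `τ` as the origin of the ray): it is integral, it is not a proper
integer multiple of an integral vector (in particular `v ≠ 0`), and it points from `τ` into `σ`. -/
def IsPrimitiveGenerator {n : ℕ} (σ τ : Set (Space n)) (v : Space n ⧸ vectorSpan ℝ τ) : Prop :=
  IsIntegral τ v ∧
  (∀ w, IsIntegral τ w → ∀ k : ℕ, v = k • w → k = 1) ∧
  ∃ y ∈ τ, ∃ x ∈ σ, ∃ t : ℝ, 0 < t ∧ v = t • Submodule.Quotient.mk (x - y)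

/-- A finite, rational polyhedral complex in `ℝⁿ`, pure of dimension `d`. It may be empty. -/
structure PolyhedralComplex (n d : ℕ) where
  /-- the cells of the complex -/
  cells : Finset (Set (Space n))
  nonempty : ∀ σ ∈ cells, σ.Nonempty
  rational : ∀ σ ∈ cells, IsRationalPolyhedron σ
  face_mem : ∀ σ ∈ cells, ∀ τ, IsFace τ σ → τ ∈ cells
  inter_face : ∀ σ ∈ cells, ∀ σ' ∈ cells, (σ ∩ σ').Nonempty → IsFace (σ ∩ σ') σ
  pure : ∀ τ ∈ cells, ∃ σ ∈ cells, dim σ = d ∧ τ ⊆ σ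

/-- The facets of a complex: its cells of top dimension `d`. -/
noncomputable def PolyhedralComplex.facets {n d : ℕ} (C : PolyhedralComplex n d) :
    Finset (Set (Space n)) :=
  open Classical in C.cells.filter (fun σ => dim σ = d)

/-- The facets of a complex that contain the cell `τ`. -/
noncomputable def PolyhedralComplex.facetsAround {n d : ℕ} (C : PolyhedralComplex n d)
    (τ : Set (Space n)) : Finset (Set (Space n)) :=
  open Classical in C.facets.filter (fun σ => τ ⊆ σ)

/-- The balancing condition at `τ` for the weights `ω`:
`∑_{σ > τ} ω(σ) v_{σ/τ} = 0` in `ℝⁿ / V_τ`, the sum being over the facets `σ` around `τ`. -/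
def PolyhedralComplex.BalancedAt {n d : ℕ} (C : PolyhedralComplex n d)
    (ω : Set (Space n) → ℤ) (τ : Set (Space n)) : Prop :=
  ∃ v : Set (Space n) → Space n ⧸ vectorSpan ℝ τ,
    (∀ σ ∈ C.facetsAround τ, IsPrimitiveGenerator σ τ (v σ)) ∧
    ∑ σ ∈ C.facetsAround τ, ω σ • v σ = 0

/-- A tropical polyhedral complex of dimension `d` in `ℝⁿ`: a polyhedral complex with integer
weights on its facets (only the values of `weight` on facets matter, and they may be zero) that
is balanced at every ridge, that is, at every cell of codimension one. -/
structure TropicalComplex (n d : ℕ) extends PolyhedralComplex n d where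
  /-- the weights of the facets -/
  weight : Set (Space n) → ℤ
  balanced : ∀ τ ∈ cells, dim τ + 1 = d → toPolyhedralComplex.BalancedAt weight τ

/-- The support: the union of the facets of nonzero weight. -/
def TropicalComplex.support {n d : ℕ} (X : TropicalComplex n d) : Set (Space n) :=
  {x | ∃ σ ∈ X.facets, X.weight σ ≠ 0 ∧ x ∈ σ}

/-- A set is negligible in dimension `d` if it lies in a finite union of affine subspaces of
dimension less than `d`. For `d = 0` only the empty set is negligible. -/
def Negligible {n : ℕ} (d : ℕ) (s : Set (Space n)) : Prop :=
  ∃ S : Finset (AffineSubspace ℝ (Space n)),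
    (∀ A ∈ S, Module.finrank ℝ A.direction < d) ∧ ∀ x ∈ s, ∃ A ∈ S, x ∈ A

/-- The functions `ℝⁿ → ℤ` that vanish outside a set which is negligible in dimension `d`. -/
def negligibleFunctions (n d : ℕ) : AddSubgroup (Space n → ℤ) where
  carrier := {f | Negligible d {x | f x ≠ 0}}
  zero_mem' := ⟨∅, by simp, by simp⟩
  add_mem' := by
    classical
    rintro f g ⟨S, hS, hf⟩ ⟨T, hT, hg⟩
    refine ⟨S ∪ T, fun A hA => ?_, fun x hx => ?_⟩
    · rcases Finset.mem_union.1 hA with h | h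
      exacts [hS A h, hT A h]
    · by_cases h : f x = 0
      · have h' : g x ≠ 0 := fun h' => hx (by simp [h, h'])
        obtain ⟨A, hA, hxA⟩ := hg x h'
        exact ⟨A, Finset.mem_union_right _ hA, hxA⟩
      · obtain ⟨A, hA, hxA⟩ := hf x h
        exact ⟨A, Finset.mem_union_left _ hA, hxA⟩
  neg_mem' := by
    rintro f ⟨S, hS, hf⟩
    exact ⟨S, hS, fun x hx => hf x fun h => hx (by simp [h])⟩

/-- Generic weights of dimension `d` on `ℝⁿ`: integer weights `ω(p)` of points `p`, where two
weightings are identified if they agree at all `p` outside a negligible set. It is a group under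
addition of weights. -/
abbrev GenericWeight (n d : ℕ) : Type := (Space n → ℤ) ⧸ negligibleFunctions n d

/-- The generic weight of a tropical polyhedral complex: at a generic point `p`, which lies in at
most one facet, it is the weight of the facet containing `p`, and zero if there is none.
Two complexes have the same generic weight if and only if, up to facets of weight zero, they have
a common refinement with the same induced weights. -/
noncomputable def TropicalComplex.genericWeight {n d : ℕ} (X : TropicalComplex n d) :
    GenericWeight n d :=
  open Classical in
  QuotientAddGroup.mk (fun p => ∑ σ ∈ X.facets.filter (fun σ => p ∈ σ), X.weight σ)

/-- A tropical cycle of dimension `d` in `ℝⁿ`: a generic weight which comes from some tropical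
polyhedral complex. -/
def IsTropicalCycle {n d : ℕ} (X : GenericWeight n d) : Prop :=
  ∃ C : TropicalComplex n d, C.genericWeight = X

/-- A fan cycle: a tropical cycle whose support is a union of cones with vertex at `0`. -/
def IsFanCycle {n d : ℕ} (F : GenericWeight n d) : Prop :=
  ∃ C : TropicalComplex n d, C.genericWeight = F ∧
    ∀ x ∈ C.support, ∀ t : ℝ, 0 ≤ t → t • x ∈ C.support

/-- Translation by `p` as a map of integer-valued functions. -/
def translateFun {n : ℕ} (p : Space n) : (Space n → ℤ) →+ (Space n → ℤ) where
  toFun f := fun x => f (x - p)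
  map_zero' := rfl
  map_add' _ _ := rfl

theorem translateFun_negligible {n : ℕ} (d : ℕ) (p : Space n) :
    negligibleFunctions n d ≤ (negligibleFunctions n d).comap (translateFun p) := by
  classical
  rintro f ⟨S, hS, hf⟩
  refine ⟨S.image (fun A => A.map (AffineEquiv.constVAdd ℝ (Space n) p).toAffineMap),
    fun B hB => ?_, fun x hx => ?_⟩
  · obtain ⟨A, hA, rfl⟩ := Finset.mem_image.1 hB
    have h := hS A hA
    rw [AffineSubspace.map_direction]
    exact lt_of_le_of_lt (Submodule.finrank_map_le _ _) h
  · obtain ⟨A, hA, hxA⟩ := hf (x - p) hx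
    exact ⟨_, Finset.mem_image_of_mem _ hA, x - p, hxA, by simp⟩

/-- The translate `X + p`: its weight at `x` is the weight of `X` at `x - p`. -/
def translate {n d : ℕ} (p : Space n) : GenericWeight n d →+ GenericWeight n d :=
  QuotientAddGroup.map _ _ (translateFun p) (translateFun_negligible d p)

end Tropical

/-!
The star of a tropical complex at a point `p`, that is, the collection of the local cones at `p` of
the cells containing `p`, is balanced because its ridges are the local cones of the ridges through
`p`, and thus it is a fan cycle (`TropicalComplex.star`, `TropicalComplex.isFanCycle_star`).
Every tropical complex `X` is an integer combination of translated stars, one at a relatively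
interior point `p τ` of each cell `τ`. The coefficient `c τ` is the Euler characteristic of the
relative interior of `τ`, normalised so that every nonempty closed polyhedron has Euler
characteristic `1`; equivalently, `∑ τ ⊆ κ, c τ = 1` for every cell `κ`. Comparing the
contributions of each facet, this decomposition follows from an identity of
Brianchon–Gram type (`PolyhedralComplex.exists_indicator_eq_sum_localCone`): for every cell `σ`,
`[x ∈ σ] = ∑ τ ⊆ σ, c τ * [x ∈ p τ + localCone (p τ) σ]`.
As the Euler characteristic of a closed polyhedron is `1` even if it is unbounded or contains a
line, the cells need not be compact or pointed.

A point `x` fails to lie in the cone of `σ` at `p τ` exactly if one of the inequalities of `σ` is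
violated at `x` and an equality at `p τ`, that is, if `p τ` lies on the part of the boundary visible
from `x`. If `x ∈ σ`, the identity is the normalisation of `c`. If `x ∉ σ`, inclusion-exclusion over
the violated inequalities turns it into the vanishing of an alternating sum over those sets `J` of
violated inequalities for which the corresponding face is nonempty
(`sum_neg_one_pow_faceOf_nonempty`). Each segment from `x`
passes through the visible boundary at most once, so the shadows of these faces as seen from `x`
satisfy the relation of inclusion-exclusion as indicator functions. The shadows are closed and
convex, and a linear relation between indicator functions of nonempty closed convex sets remains
true if each function is replaced by `1` (`sum_eq_zero_of_isClosed`). This last fact, the existence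
of the Euler characteristic, is proved by slicing.
-/

namespace Tropical

/-! ### The Euler relation for closed convex sets -/

theorem sum_eq_zero_of_sum_Icc_eq_zero {ι : Type*} (s : Finset ι) (c : ι → ℤ) (a b : ι → ℝ)
    (hab : ∀ i ∈ s, a i ≤ b i)
    (h : ∀ t, ∑ i ∈ s, (if a i ≤ t ∧ t ≤ b i then c i else 0) = 0) :
    ∑ i ∈ s, c i = 0 := by
  classical
  -- The intervals ending at `t` are those that contain `t` but not a point just to the right.
  have key : ∀ t, ∑ i ∈ s with b i = t, c i = 0 := by
    intro t
    have hev : ∀ᶠ u in nhdsWithin t (Set.Ioi t),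
        ∀ i ∈ s, (t < a i → u < a i) ∧ (t < b i → u < b i) := by
      rw [Filter.eventually_all_finset]
      intro i _
      have aux : ∀ r : ℝ, ∀ᶠ u in nhdsWithin t (Set.Ioi t), t < r → u < r := by
        intro r
        by_cases hr : t < r
        · filter_upwards [nhdsWithin_le_nhds (Iio_mem_nhds hr)] with u hu _ using hu
        · exact Filter.Eventually.of_forall fun u hu => absurd hu hr
      exact (aux _).and (aux _)
    obtain ⟨u, hu, htu⟩ := (hev.and self_mem_nhdsWithin).exists
    have htu : t < u := htu
    have hdiff := congrArg₂ (· - ·) (h t) (h u)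
    simp only [← Finset.sum_sub_distrib, sub_zero] at hdiff
    rw [Finset.sum_filter]
    refine (Finset.sum_congr rfl fun i hi => ?_).trans hdiff
    obtain ⟨h1, h2⟩ := hu i hi
    have h3 := hab i hi
    split_ifs <;> grind
  rw [← Finset.sum_fiberwise_of_maps_to (t := s.image b) (g := b)
    (fun i hi => Finset.mem_image_of_mem b hi)]
  exact Finset.sum_eq_zero fun t _ => key t

open Classical in
/-- The Euler characteristic is well defined on integer combinations of indicator functions of
compact convex sets. Slicing along the first coordinate reduces it to the projections to that
coordinate, which are compact intervals. -/
theorem sum_eq_zero_of_isCompact {ι : Type*} (n : ℕ) (s : Finset ι) (c : ι → ℤ)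
    (A : ι → Set (Fin n → ℝ)) (hA : ∀ i ∈ s, (A i).Nonempty) (hc : ∀ i ∈ s, IsCompact (A i))
    (hconv : ∀ i ∈ s, Convex ℝ (A i)) (h : ∀ x, ∑ i ∈ s, (if x ∈ A i then c i else 0) = 0) :
    ∑ i ∈ s, c i = 0 := by
  induction n generalizing s with
  | zero =>
    rw [← h default]
    refine Finset.sum_congr rfl fun i hi => ?_
    obtain ⟨x, hx⟩ := hA i hi
    rw [if_pos (by rwa [Subsingleton.elim default x])]
  | succ n ih =>
    have hint : ∀ i, ∃ a b : ℝ, i ∈ s → (a ≤ b ∧ (fun x => x 0) '' A i = Set.Icc a b) := by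
      intro i
      by_cases hi : i ∈ s
      · have hne : ((fun x : Fin (n + 1) → ℝ => x 0) '' A i).Nonempty := (hA i hi).image _
        have hcp : IsCompact ((fun x : Fin (n + 1) → ℝ => x 0) '' A i) :=
          (hc i hi).image (continuous_apply 0)
        have hcn : IsConnected ((fun x : Fin (n + 1) → ℝ => x 0) '' A i) :=
          ⟨hne, (hconv i hi).isPreconnected.image _ (continuous_apply 0).continuousOn⟩
        have := eq_Icc_of_connected_compact hcn hcp
        refine ⟨_, _, fun _ => ⟨?_, this⟩⟩
        rw [this] at hne
        exact Set.nonempty_Icc.1 hne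
      · exact ⟨0, 0, fun h => absurd h hi⟩
    choose a b hab using hint
    refine sum_eq_zero_of_sum_Icc_eq_zero s c a b (fun i hi => (hab i hi).1) fun t => ?_
    have hslice : ∀ i ∈ s, (a i ≤ t ∧ t ≤ b i) ↔ ∃ y : Fin n → ℝ, Fin.cons t y ∈ A i := by
      intro i hi
      rw [← Set.mem_Icc, ← (hab i hi).2]
      constructor
      · rintro ⟨x, hx, rfl⟩
        exact ⟨Fin.tail x, by simpa using hx⟩
      · rintro ⟨y, hy⟩
        exact ⟨_, hy, by simp⟩
    rw [← Finset.sum_filter]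
    refine ih _ (fun i => {y | (Fin.cons t y : Fin (n + 1) → ℝ) ∈ A i}) ?_ ?_ ?_ ?_
    · intro i hi
      rw [Finset.mem_filter] at hi
      exact (hslice i hi.1).1 hi.2
    · intro i hi
      have hi := (Finset.mem_filter.1 hi).1
      have hsub : {y | (Fin.cons t y : Fin (n + 1) → ℝ) ∈ A i} ⊆ Fin.tail '' A i :=
        fun y hy => ⟨_, hy, by simp⟩
      refine ((hc i hi).image (f := fun x : Fin (n + 1) → ℝ => (Fin.tail x : Fin n → ℝ))
        (by unfold Fin.tail; fun_prop)).of_isClosed_subset ?_ hsub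
      refine (hc i hi).isClosed.preimage (f := fun y : Fin n → ℝ => (Fin.cons t y : Fin (n + 1) → ℝ))
        (continuous_pi fun j => ?_)
      refine Fin.cases ?_ (fun j => ?_) j
      · simpa using continuous_const
      · simpa using continuous_apply j
    · intro i hi y hy z hz α β hα hβ hαβ
      have := hconv i (Finset.mem_filter.1 hi).1 hy hz hα hβ hαβ
      change (Fin.cons t (α • y + β • z) : Fin (n + 1) → ℝ) ∈ A i
      convert this using 1
      refine funext fun j => Fin.cases ?_ (fun j => ?_) j
      · simp [← add_mul, hαβ]
      · simp
    · intro y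
      rw [Finset.sum_filter]
      refine (Finset.sum_congr rfl fun i hi => ?_).trans (h (Fin.cons t y))
      by_cases hy : (Fin.cons t y : Fin (n + 1) → ℝ) ∈ A i
      · simp [hy, (hslice i hi).2 ⟨y, hy⟩]
      · simp [hy]

open Classical in
/-- The Euler relation for closed convex sets, obtained from the compact case by intersecting with
a ball that meets all of them. -/
theorem sum_eq_zero_of_isClosed {ι : Type*} {n : ℕ} (s : Finset ι) (c : ι → ℤ)
    (A : ι → Set (Fin n → ℝ)) (hA : ∀ i ∈ s, (A i).Nonempty) (hc : ∀ i ∈ s, IsClosed (A i))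
    (hconv : ∀ i ∈ s, Convex ℝ (A i)) (h : ∀ x, ∑ i ∈ s, (if x ∈ A i then c i else 0) = 0) :
    ∑ i ∈ s, c i = 0 := by
  have hex : ∀ i, ∃ x, i ∈ s → x ∈ A i := fun i => by
    by_cases hi : i ∈ s
    · exact (hA i hi).imp fun x hx _ => hx
    · exact ⟨0, fun h => absurd h hi⟩
  choose q hq using hex
  obtain ⟨R, hR⟩ : ∃ R : ℝ, ∀ i ∈ s, ‖q i‖ ≤ R :=
    ⟨∑ i ∈ s, ‖q i‖, fun i hi => Finset.single_le_sum (f := fun i => ‖q i‖)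
      (fun _ _ => norm_nonneg _) hi⟩
  refine sum_eq_zero_of_isCompact n s c (fun i => A i ∩ Metric.closedBall 0 R) ?_ ?_ ?_ ?_
  · exact fun i hi => ⟨q i, hq i hi, by simpa using hR i hi⟩
  · exact fun i hi => (isCompact_closedBall 0 R).inter_left (hc i hi)
  · exact fun i hi => (hconv i hi).inter (convex_closedBall 0 R)
  · intro x
    by_cases hx : x ∈ Metric.closedBall (0 : Fin n → ℝ) R
    · simpa [hx] using h x
    · exact Finset.sum_eq_zero fun i _ => if_neg fun h => hx h.2

/-! ### Faces of a polyhedron seen from an outside point -/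

open Classical in
theorem sum_powerset_filter_neg_one_pow {ι : Type*} (I : Finset ι) (q : ι → Prop) :
    ∑ J ∈ I.powerset, (if ∀ i ∈ J, q i then (-1 : ℤ) ^ J.card else 0) =
      if ∀ i ∈ I, ¬ q i then 1 else 0 := by
  have h1 : I.powerset.filter (fun J => ∀ i ∈ J, q i) = (I.filter q).powerset := by
    ext J
    simp only [Finset.mem_filter, Finset.mem_powerset, Finset.subset_iff]
    exact ⟨fun h i hi => ⟨h.1 hi, h.2 i hi⟩, fun h => ⟨fun i hi => (h hi).1, fun i hi => (h hi).2⟩⟩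
  rw [← Finset.sum_filter, h1, Finset.sum_powerset_neg_one_pow_card]
  simp only [Finset.filter_eq_empty_iff]

/-- The set of points `z` such that the segment from `x` to `z` meets `S`. -/
def shadow {n : ℕ} (x : Space n) (S : Set (Space n)) : Set (Space n) :=
  {z | ∃ s ∈ Set.Icc (0 : ℝ) 1, AffineMap.lineMap x z s ∈ S}

theorem shadow_nonempty_iff {n : ℕ} {x : Space n} {S : Set (Space n)} :
    (shadow x S).Nonempty ↔ S.Nonempty :=
  ⟨fun ⟨_, _, _, h⟩ => ⟨_, h⟩, fun ⟨y, hy⟩ => ⟨y, 1, by simp, by simpa using hy⟩⟩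

theorem isClosed_shadow {n : ℕ} (x : Space n) {S : Set (Space n)} (hS : IsClosed S) :
    IsClosed (shadow x S) := by
  have h : shadow x S = Prod.fst ''
      ({q : Space n × Set.Icc (0 : ℝ) 1 | AffineMap.lineMap x q.1 (q.2 : ℝ) ∈ S}) := by
    ext z
    constructor
    · rintro ⟨s, hs, h⟩
      exact ⟨(z, ⟨s, hs⟩), h, rfl⟩
    · rintro ⟨⟨z, s⟩, h, rfl⟩
      exact ⟨s, s.2, h⟩
  rw [h]
  refine isClosedMap_fst_of_compactSpace _ (hS.preimage ?_)
  simp only [AffineMap.lineMap_apply_module]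
  fun_prop

theorem convex_shadow {n : ℕ} (x : Space n) {S : Set (Space n)} (hS : Convex ℝ S) :
    Convex ℝ (shadow x S) := by
  rintro z ⟨s, ⟨hs0, hs1⟩, hz⟩ w ⟨t, ⟨ht0, ht1⟩, hw⟩ α β hα hβ hαβ
  simp only [AffineMap.lineMap_apply_module] at hz hw
  rcases eq_or_lt_of_le hs0 with rfl | hs
  · exact ⟨0, by simp, by simpa using hz⟩
  rcases eq_or_lt_of_le ht0 with rfl | ht
  · exact ⟨0, by simp, by simpa using hw⟩
  -- The point of parameter `r` is the convex combination, with weights proportional to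
  -- `α / s` and `β / t`, of the two given points of `S`.
  have hpos : 0 < α * t + β * s := by
    rcases eq_or_lt_of_le hα with rfl | h
    · have : β = 1 := by linarith
      subst this; simpa using hs
    · have := mul_pos h ht
      have := mul_nonneg hβ hs.le
      linarith
  have hne := hpos.ne'
  refine ⟨s * t / (α * t + β * s), ⟨by positivity, ?_⟩, ?_⟩
  · rw [div_le_one hpos]
    have h1 : α * t * s ≤ α * t := mul_le_of_le_one_right (by positivity) hs1
    have h2 : β * s * t ≤ β * s := mul_le_of_le_one_right (by positivity) ht1
    have h3 : s * t = α * t * s + β * s * t := by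
      rw [show β = 1 - α by linarith]; ring
    linarith
  · have := hS hz hw (a := α * t / (α * t + β * s)) (b := β * s / (α * t + β * s))
      (by positivity) (by positivity) (by field_simp)
    convert this using 1
    rw [AffineMap.lineMap_apply_module]
    generalize hD : α * t + β * s = D at hne
    ext j
    simp only [Pi.add_apply, Pi.smul_apply, smul_eq_mul]
    field_simp
    linear_combination -x j * hD + s * t * x j * hαβ

section Polyhedron

variable {n : ℕ} {ι : Type*} (s : Finset ι) (L : ι → StrongDual ℝ (Space n)) (b : ι → ℝ)

/-- The polyhedron of the solutions of the inequalities `L i y ≤ b i`, for `i ∈ s`, in which those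
with `i ∈ J` are equalities. -/
def faceOf (J : Finset ι) : Set (Space n) :=
  {y | (∀ i ∈ s, L i y ≤ b i) ∧ ∀ i ∈ J, L i y = b i}

theorem isClosed_faceOf (J : Finset ι) : IsClosed (faceOf s L b J) := by
  have : faceOf s L b J =
      (⋂ i ∈ s, {y | L i y ≤ b i}) ∩ ⋂ i ∈ J, {y | L i y = b i} := by
    ext y; simp [faceOf]
  rw [this]
  exact (isClosed_biInter fun i _ => isClosed_le (L i).continuous continuous_const).inter
    (isClosed_biInter fun i _ => isClosed_eq (L i).continuous continuous_const)

theorem convex_faceOf (J : Finset ι) : Convex ℝ (faceOf s L b J) := by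
  have : faceOf s L b J =
      (⋂ i ∈ s, {y | L i y ≤ b i}) ∩ ⋂ i ∈ J, {y | L i y = b i} := by
    ext y; simp [faceOf]
  rw [this]
  exact (convex_iInter₂ fun i _ => convex_halfSpace_le (L i).toLinearMap.isLinear _).inter
    (convex_iInter₂ fun i _ => convex_hyperplane (L i).toLinearMap.isLinear _)

theorem isFace_faceOf {J : Finset ι} (hJ : J ⊆ s) (hne : (faceOf s L b J).Nonempty) :
    IsFace (faceOf s L b J) (faceOf s L b ∅) := by
  refine ⟨hne, fun _ => ⟨∑ i ∈ J, L i, ?_⟩⟩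
  obtain ⟨y₀, hy₀, hy₀J⟩ := hne
  ext y
  simp only [faceOf, Finset.notMem_empty, false_imp_iff, implies_true, and_true, Set.mem_ofPred_eq]
  simp only [sum_apply]
  refine and_congr_right fun hy => ⟨fun h z hz => ?_, fun h i hi => ?_⟩
  · exact Finset.sum_le_sum fun i hi => (hz i (hJ hi)).trans (h i hi).ge
  · have h1 : ∑ i ∈ J, L i y = ∑ i ∈ J, b i :=
      le_antisymm (Finset.sum_le_sum fun i hi => hy i (hJ hi))
        ((Finset.sum_congr rfl hy₀J).symm.trans_le (h y₀ hy₀))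
    exact (Finset.sum_eq_sum_iff_of_le fun i hi => hy i (hJ hi)).1 h1 i hi

open Classical in
/-- The faces of a polyhedron visible from an outside point `x` satisfy Euler's relation for a
contractible complex: the alternating sum over the sets of violated inequalities that define a
nonempty face vanishes, the empty set included. The segments from `x` meet the visible part of the boundary at
most once, so inclusion-exclusion for the visible faces turns into one for their shadows, which
are closed and convex, as is the shadow of the whole polyhedron. -/
theorem sum_neg_one_pow_faceOf_nonempty {x : Space n} (hx : x ∉ faceOf s L b ∅) :
    ∑ J ∈ (s.filter fun i => b i < L i x).powerset,
      (if (faceOf s L b J).Nonempty then (-1 : ℤ) ^ J.card else 0) = 0 := by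
  set I := s.filter fun i => b i < L i x
  rw [← Finset.sum_filter]
  refine sum_eq_zero_of_isClosed _ _ (fun J => shadow x (faceOf s L b J)) ?_ ?_ ?_ ?_
  · intro J hJ
    exact shadow_nonempty_iff.2 (Finset.mem_filter.1 hJ).2
  · exact fun J _ => isClosed_shadow x (isClosed_faceOf s L b J)
  · exact fun J _ => convex_shadow x (convex_faceOf s L b J)
  intro z
  have hmono : ∀ J, faceOf s L b J ⊆ faceOf s L b ∅ := fun J y hy => ⟨hy.1, by simp⟩
  by_cases hz : z ∈ shadow x (faceOf s L b ∅)
  swap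
  · refine Finset.sum_eq_zero fun J _ => if_neg fun ⟨r, hr, h⟩ => hz ⟨r, hr, hmono J h⟩
  -- the first point of the polyhedron on the segment from `x` to `z`
  obtain ⟨r, ⟨hr, hrP⟩, hmin⟩ : ∃ r, IsLeast
      (Set.Icc (0 : ℝ) 1 ∩ {r | AffineMap.lineMap x z r ∈ faceOf s L b ∅}) r := by
    refine IsCompact.exists_isLeast ?_ ?_
    · exact isCompact_Icc.inter_right
        ((isClosed_faceOf s L b ∅).preimage AffineMap.lineMap_continuous)
    · obtain ⟨r, hr, h⟩ := hz
      exact ⟨r, hr, h⟩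
  have hval : ∀ i t, L i (AffineMap.lineMap x z t) = L i x + t * (L i z - L i x) := by
    intro i t
    simp only [AffineMap.lineMap_apply_module, map_add, map_smul, smul_eq_mul]
    ring
  have hr0 : 0 < r := by
    refine lt_of_le_of_ne hr.1 ?_
    rintro rfl
    exact hx (by simpa using hrP)
  have hfirst : ∀ J ∈ I.powerset, z ∈ shadow x (faceOf s L b J) ↔
      ∀ i ∈ J, L i (AffineMap.lineMap x z r) = b i := by
    intro J hJ
    have hJI := Finset.mem_powerset.1 hJ
    refine ⟨fun ⟨t, ht, htP⟩ => ?_, fun h => ⟨r, hr, hrP.1, h⟩⟩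
    intro i hi
    have hi' := Finset.mem_filter.1 (hJI hi)
    have hrt : r ≤ t := hmin ⟨ht, hmono J htP⟩
    have h1 := htP.2 i hi
    have h2 := hrP.1 i hi'.1
    have h3 := hi'.2
    rw [hval] at h1 h2 ⊢
    refine le_antisymm h2 ?_
    have h4 : L i z - L i x < 0 := by
      by_contra h
      have := mul_nonneg ht.1 (not_lt.1 h)
      linarith
    have := mul_le_mul_of_nonpos_right hrt h4.le
    linarith
  -- a violated inequality becomes an equality at that point
  have hactive : ∃ i ∈ I, L i (AffineMap.lineMap x z r) = b i := by
    by_contra hcon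
    have hlt : ∀ i ∈ I, L i (AffineMap.lineMap x z r) < b i := fun i hi =>
      lt_of_le_of_ne (hrP.1 i (Finset.mem_filter.1 hi).1) fun h => hcon ⟨i, hi, h⟩
    have hev : ∀ᶠ t in nhdsWithin r (Set.Iio r),
        0 < t ∧ ∀ i ∈ I, L i (AffineMap.lineMap x z t) < b i := by
      refine nhdsWithin_le_nhds (Filter.Eventually.and (Ioi_mem_nhds hr0) ?_)
      rw [Filter.eventually_all_finset]
      intro i hi
      have hcont : Continuous fun t : ℝ => L i (AffineMap.lineMap x z t) :=
        (L i).continuous.comp AffineMap.lineMap_continuous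
      exact hcont.continuousAt.eventually_lt continuousAt_const (hlt i hi)
    obtain ⟨t, ⟨ht0, ht⟩, htr⟩ := (hev.and self_mem_nhdsWithin).exists
    have htr : t < r := htr
    refine absurd (hmin ⟨⟨ht0.le, htr.le.trans hr.2⟩, fun i hi => ?_, by simp⟩) (not_le.2 htr)
    by_cases hiI : i ∈ I
    · exact (ht i hiI).le
    · have h1 : L i x ≤ b i := by
        by_contra h
        exact hiI (Finset.mem_filter.2 ⟨hi, not_le.1 h⟩)
      have h2 := hrP.1 i hi
      rw [hval] at h2 ⊢
      rcases le_total (L i z - L i x) 0 with h | h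
      · have := mul_nonpos_of_nonneg_of_nonpos ht0.le h
        linarith
      · have := mul_le_mul_of_nonneg_right htr.le h
        linarith
  have hzero := sum_powerset_filter_neg_one_pow I
    (fun i => L i (AffineMap.lineMap x z r) = b i)
  rw [if_neg (by push Not; exact hactive)] at hzero
  rw [Finset.sum_filter]
  refine (Finset.sum_congr rfl fun J hJ => ?_).trans hzero
  have h := hfirst J hJ
  by_cases hzJ : z ∈ shadow x (faceOf s L b J)
  · rw [if_pos (shadow_nonempty_iff.1 ⟨z, hzJ⟩), if_pos hzJ, if_pos (h.1 hzJ)]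
  · rw [if_neg fun h' => hzJ (h.2 h'), if_neg hzJ, ite_self]

end Polyhedron

/-! ### The Brianchon–Gram identity on a polyhedral complex -/

/-- The cone of directions that point from `p` into `σ`. For convex `σ` containing `p`, this is the
cone with vertex at `0` that agrees with `σ - p` near `0`. -/
def localCone {n : ℕ} (p : Space n) (σ : Set (Space n)) : Set (Space n) :=
  {v | ∃ ε : ℝ, 0 < ε ∧ p + ε • v ∈ σ}

/-- The linear form `⟨a, ·⟩`. -/
noncomputable def intForm {n : ℕ} (a : Fin n → ℤ) : StrongDual ℝ (Space n) :=
  ∑ i, (a i : ℝ) • ContinuousLinearMap.proj i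

theorem intForm_apply {n : ℕ} (a : Fin n → ℤ) (x : Space n) :
    intForm a x = ∑ i, (a i : ℝ) * x i := by
  simp [intForm]

theorem IsRationalPolyhedron.exists_eq_faceOf {n : ℕ} {σ : Set (Space n)}
    (h : IsRationalPolyhedron σ) :
    ∃ s : Finset ((Fin n → ℤ) × ℝ), σ = faceOf s (fun c => intForm c.1) (fun c => c.2) ∅ := by
  obtain ⟨s, rfl⟩ := h
  refine ⟨s, ?_⟩
  ext x
  simp [faceOf, intForm_apply]

theorem IsRationalPolyhedron.convex {n : ℕ} {σ : Set (Space n)} (h : IsRationalPolyhedron σ) :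
    Convex ℝ σ := by
  obtain ⟨s, rfl⟩ := h.exists_eq_faceOf
  exact convex_faceOf _ _ _ _

theorem mem_localCone_faceOf {n : ℕ} {ι : Type*} {s : Finset ι} {L : ι → StrongDual ℝ (Space n)}
    {b : ι → ℝ} {p : Space n} (hp : p ∈ faceOf s L b ∅) {v : Space n} :
    v ∈ localCone p (faceOf s L b ∅) ↔ ∀ i ∈ s, L i p = b i → L i v ≤ 0 := by
  constructor
  · rintro ⟨ε, hε, h⟩ i hi hip
    have := h.1 i hi
    rw [map_add, map_smul, hip, smul_eq_mul] at this
    exact nonpos_of_mul_nonpos_right (by linarith) hε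
  · intro h
    have hev : ∀ᶠ ε : ℝ in nhdsWithin 0 (Set.Ioi 0), ∀ i ∈ s, L i (p + ε • v) ≤ b i := by
      rw [Filter.eventually_all_finset]
      intro i hi
      rcases (hp.1 i hi).eq_or_lt with hip | hip
      · filter_upwards [self_mem_nhdsWithin] with ε hε
        rw [map_add, map_smul, hip, smul_eq_mul]
        have := mul_nonpos_of_nonneg_of_nonpos (le_of_lt hε) (h i hi hip)
        linarith
      · refine nhdsWithin_le_nhds ?_
        have hcont : Continuous fun ε : ℝ => L i (p + ε • v) := by fun_prop
        filter_upwards [hcont.continuousAt.eventually_lt continuousAt_const (by simpa using hip)]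
          with ε hε using hε.le
    obtain ⟨ε, h1, h2⟩ := (hev.and self_mem_nhdsWithin).exists
    exact ⟨ε, h2, h1, by simp⟩

theorem exists_mem_forall_notMem_face {n : ℕ} {τ : Set (Space n)} (hne : τ.Nonempty)
    (hconv : Convex ℝ τ) (T : Finset (Set (Space n))) (hT : ∀ κ ∈ T, IsFace κ τ ∧ κ ≠ τ) :
    ∃ p ∈ τ, ∀ κ ∈ T, p ∉ κ := by
  classical
  induction T using Finset.induction_on with
  | empty => exact ⟨_, hne.some_mem, by simp⟩
  | insert κ T _ ih =>
    obtain ⟨p, hp, hpT⟩ := ih fun κ' hκ' => hT κ' (Finset.mem_insert_of_mem hκ')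
    obtain ⟨hκ, hκne⟩ := hT κ (Finset.mem_insert_self κ T)
    obtain ⟨q, hq, hqκ⟩ : ∃ q ∈ τ, q ∉ κ := by
      by_contra! h
      exact hκne (hκ.2.subset.antisymm h)
    have hmem : midpoint ℝ p q ∈ openSegment ℝ p q := midpoint_mem_openSegment p q
    refine ⟨midpoint ℝ p q, hconv.openSegment_subset hp hq hmem, fun κ' hκ' hm => ?_⟩
    have hext := (hT κ' hκ').1.2.isExtreme
    rcases Finset.mem_insert.1 hκ' with rfl | h
    · exact hqκ (hext.right_mem_of_mem_openSegment hp hq hm hmem)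
    · exact hpT κ' h (hext.left_mem_of_mem_openSegment hp hq hm hmem)

theorem exists_forall_sum_le_eq_one {α : Type*} [PartialOrder α] [DecidableLE α] (S : Finset α) :
    ∃ c : α → ℤ, ∀ a ∈ S, ∑ b ∈ S, (if b ≤ a then c b else 0) = 1 := by
  classical
  induction hk : S.card generalizing S with
  | zero => exact ⟨0, by simp [Finset.card_eq_zero.1 hk]⟩
  | succ k ih =>
    obtain ⟨m, hm⟩ := S.exists_maximal (Finset.card_pos.1 (by omega))
    obtain ⟨c, hc⟩ := ih (S.erase m) (by rw [Finset.card_erase_of_mem hm.1, hk]; rfl)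
    have hold : ∀ a e, ∑ b ∈ S.erase m, (if b ≤ a then Function.update c m e b else 0) =
        ∑ b ∈ S.erase m, (if b ≤ a then c b else 0) := fun a e =>
      Finset.sum_congr rfl fun b hb => by
        rw [Function.update_of_ne (Finset.ne_of_mem_erase hb)]
    refine ⟨Function.update c m (1 - ∑ b ∈ S.erase m, (if b ≤ m then c b else 0)),
      fun a ha => ?_⟩
    rw [← Finset.add_sum_erase _ _ hm.1, hold]
    by_cases ham : a = m
    · subst ham; simp
    · rw [if_neg fun h => ham ((hm.eq_of_le ha h).symm), zero_add]
      exact hc a (Finset.mem_erase.2 ⟨ham, ha⟩)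

section Complex

variable {n d : ℕ} (C : PolyhedralComplex n d)

/-- Each cell has a point (in its relative interior) that lies in no cell but those containing the
whole of it. -/
theorem PolyhedralComplex.exists_generic_points :
    ∃ p : Set (Space n) → Space n, ∀ τ ∈ C.cells, ∀ κ ∈ C.cells, p τ ∈ κ ↔ τ ⊆ κ := by
  classical
  have hex : ∀ τ, ∃ p : Space n, τ ∈ C.cells → ∀ κ ∈ C.cells, p ∈ κ ↔ τ ⊆ κ := by
    intro τ
    by_cases hτ : τ ∈ C.cells
    · obtain ⟨p, hp, hpT⟩ := exists_mem_forall_notMem_face (C.nonempty τ hτ)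
        (C.rational τ hτ).convex (C.cells.filter fun κ => IsFace κ τ ∧ κ ≠ τ)
        fun κ hκ => (Finset.mem_filter.1 hκ).2
      refine ⟨p, fun _ κ hκ => ⟨fun hpκ => ?_, fun h => h hp⟩⟩
      have hface := C.inter_face τ hτ κ hκ ⟨p, hp, hpκ⟩
      by_contra hsub
      refine hpT (τ ∩ κ) (Finset.mem_filter.2 ⟨C.face_mem τ hτ _ hface, hface, ?_⟩) ⟨hp, hpκ⟩
      exact fun h => hsub (Set.inter_eq_left.1 h)
    · exact ⟨0, fun h => absurd h hτ⟩
  choose p hp using hex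
  exact ⟨p, fun τ hτ => hp τ hτ⟩

open Classical in
/-- The Brianchon–Gram identity: the indicator function of every cell is the combination, with
coefficients independent of the cell, of the indicator functions of its tangent cones at the chosen
points. The coefficient of a cell `τ` is the Euler characteristic of its relative interior. -/
theorem PolyhedralComplex.exists_indicator_eq_sum_localCone :
    ∃ (p : Set (Space n) → Space n) (c : Set (Space n) → ℤ), ∀ σ ∈ C.cells, ∀ x,
      (if x ∈ σ then 1 else 0) =
        ∑ τ ∈ C.cells, (if p τ ∈ σ ∧ x - p τ ∈ localCone (p τ) σ then c τ else 0) := by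
  obtain ⟨p, hp⟩ := C.exists_generic_points
  obtain ⟨c, hc⟩ := exists_forall_sum_le_eq_one C.cells
  refine ⟨p, c, fun σ hσ x => ?_⟩
  have hcell : ∀ κ ∈ C.cells, ∑ τ ∈ C.cells, (if p τ ∈ κ then c τ else 0) = 1 := by
    intro κ hκ
    rw [← hc κ hκ]
    refine Finset.sum_congr rfl fun τ hτ => ?_
    by_cases h : τ ⊆ κ
    · rw [if_pos ((hp τ hτ κ hκ).2 h), if_pos h]
    · rw [if_neg fun h' => h ((hp τ hτ κ hκ).1 h'), if_neg h]
  obtain ⟨s, hs⟩ := (C.rational σ hσ).exists_eq_faceOf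
  generalize (fun c : (Fin n → ℤ) × ℝ => intForm c.1) = L at hs
  generalize (fun c : (Fin n → ℤ) × ℝ => c.2) = b at hs
  set I := s.filter fun i => b i < L i x with hI
  have hterm : ∀ τ ∈ C.cells,
      (if p τ ∈ σ ∧ x - p τ ∈ localCone (p τ) σ then c τ else 0) =
        ∑ J ∈ I.powerset, (-1) ^ J.card * (if p τ ∈ faceOf s L b J then c τ else 0) := by
    intro τ _
    by_cases hpσ : p τ ∈ σ
    swap
    · rw [if_neg fun h => hpσ h.1]
      refine (Finset.sum_eq_zero fun J _ => ?_).symm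
      rw [if_neg, mul_zero]
      rw [hs] at hpσ
      exact fun h => hpσ ⟨h.1, by simp⟩
    have hpP : p τ ∈ faceOf s L b ∅ := hs ▸ hpσ
    have hiff : (p τ ∈ σ ∧ x - p τ ∈ localCone (p τ) σ) ↔ ∀ i ∈ I, ¬ L i (p τ) = b i := by
      rw [hs, mem_localCone_faceOf hpP]
      refine ⟨fun h i hi hip => ?_, fun h => ⟨hpP, fun i hi hip => ?_⟩⟩
      · have := h.2 i (Finset.mem_filter.1 hi).1 hip
        rw [map_sub, hip] at this
        exact absurd (Finset.mem_filter.1 hi).2 (by linarith)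
      · have : ¬ b i < L i x := fun h' => h i (Finset.mem_filter.2 ⟨hi, h'⟩) hip
        rw [map_sub, hip]
        linarith
    have hmem : ∀ J, p τ ∈ faceOf s L b J ↔ ∀ i ∈ J, L i (p τ) = b i :=
      fun J => ⟨fun h => h.2, fun h => ⟨hpP.1, h⟩⟩
    have := sum_powerset_filter_neg_one_pow I (fun i => L i (p τ) = b i)
    simp only [hiff, hmem]
    rw [← mul_one (c τ), ← mul_zero (c τ), ← mul_ite, ← this, Finset.mul_sum]
    refine Finset.sum_congr rfl fun J _ => ?_
    split_ifs <;> ring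
  rw [Finset.sum_congr rfl hterm, Finset.sum_comm]
  have hJ : ∀ J ∈ I.powerset,
      ∑ τ ∈ C.cells, (-1) ^ J.card * (if p τ ∈ faceOf s L b J then c τ else 0) =
        if (faceOf s L b J).Nonempty then (-1 : ℤ) ^ J.card else 0 := by
    intro J hJ
    rw [← Finset.mul_sum]
    by_cases hne : (faceOf s L b J).Nonempty
    · have hJs : J ⊆ s := (Finset.mem_powerset.1 hJ).trans (Finset.filter_subset _ _)
      rw [if_pos hne, hcell _ (C.face_mem σ hσ _ (hs ▸ isFace_faceOf s L b hJs hne)), mul_one]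
    · rw [if_neg hne, Finset.sum_eq_zero, mul_zero]
      exact fun τ _ => if_neg fun h => hne ⟨_, h⟩
  rw [Finset.sum_congr rfl hJ]
  by_cases hx : x ∈ σ
  · have hI0 : I = ∅ := by
      rw [hI, Finset.filter_eq_empty_iff]
      intro i hi
      rw [hs] at hx
      exact not_lt.2 (hx.1 i hi)
    have hne : (faceOf s L b ∅).Nonempty := hs ▸ C.nonempty σ hσ
    simp [hx, hI0, hne]
  · rw [if_neg hx, sum_neg_one_pow_faceOf_nonempty s L b (hs ▸ hx)]

end Complex

/-! ### Local cones -/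

section LocalCone

variable {n : ℕ} {p : Space n} {σ σ' ρ : Set (Space n)}

theorem sub_mem_localCone {y : Space n} (hy : y ∈ σ) : y - p ∈ localCone p σ :=
  ⟨1, one_pos, by simpa using hy⟩

theorem zero_mem_localCone (hp : p ∈ σ) : (0 : Space n) ∈ localCone p σ :=
  ⟨1, one_pos, by simpa using hp⟩

theorem smul_mem_localCone (hp : p ∈ σ) {v : Space n} (hv : v ∈ localCone p σ) {t : ℝ}
    (ht : 0 ≤ t) : t • v ∈ localCone p σ := by
  rcases ht.eq_or_lt with rfl | ht
  · simpa using zero_mem_localCone hp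
  · obtain ⟨ε, hε, h⟩ := hv
    refine ⟨ε / t, by positivity, ?_⟩
    rwa [smul_smul, div_mul_cancel₀ _ ht.ne']

theorem add_smul_mem_of_le (hσ : Convex ℝ σ) (hp : p ∈ σ) {v : Space n} {ε δ : ℝ} (hδ : 0 ≤ δ)
    (hδε : δ ≤ ε) (hv : p + ε • v ∈ σ) : p + δ • v ∈ σ := by
  rcases hδ.eq_or_lt with rfl | hδ
  · simpa using hp
  · have hε : 0 < ε := hδ.trans_le hδε
    have := hσ.add_smul_mem hp hv (t := δ / ε) ⟨by positivity, (div_le_one hε).2 hδε⟩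
    rwa [smul_smul, div_mul_cancel₀ _ hε.ne'] at this

theorem localCone_inter (hσ : Convex ℝ σ) (hσ' : Convex ℝ σ') (hp : p ∈ σ) (hp' : p ∈ σ') :
    localCone p (σ ∩ σ') = localCone p σ ∩ localCone p σ' := by
  ext v
  constructor
  · rintro ⟨ε, hε, h, h'⟩
    exact ⟨⟨ε, hε, h⟩, ⟨ε, hε, h'⟩⟩
  · rintro ⟨⟨ε, hε, h⟩, ⟨δ, hδ, h'⟩⟩
    exact ⟨min ε δ, lt_min hε hδ,
      add_smul_mem_of_le hσ hp (lt_min hε hδ).le (min_le_left _ _) h,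
      add_smul_mem_of_le hσ' hp' (lt_min hε hδ).le (min_le_right _ _) h'⟩

theorem vectorSpan_localCone (hp : p ∈ σ) :
    vectorSpan ℝ (localCone p σ) = vectorSpan ℝ σ := by
  rw [vectorSpan_eq_span_vsub_set_right ℝ (zero_mem_localCone hp),
    vectorSpan_eq_span_vsub_set_right ℝ hp]
  refine le_antisymm (Submodule.span_le.2 ?_) (Submodule.span_mono ?_)
  · rintro _ ⟨v, ⟨ε, hε, h⟩, rfl⟩
    have hmem : (p + ε • v) -ᵥ p ∈ Submodule.span ℝ ((· -ᵥ p) '' σ) :=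
      Submodule.subset_span ⟨_, h, rfl⟩
    have := Submodule.smul_mem _ ε⁻¹ hmem
    simpa [smul_smul, inv_mul_cancel₀ hε.ne'] using this
  · rintro _ ⟨y, hy, rfl⟩
    exact ⟨y - p, sub_mem_localCone hy, by simp⟩

theorem dim_localCone (hp : p ∈ σ) : dim (localCone p σ) = dim σ := by
  rw [dim, dim, vectorSpan_localCone hp]

/-- Taking local cones commutes with taking the face of a linear form that attains its maximum
at the vertex. -/
theorem localCone_setOf_forall_le (hp : p ∈ σ) (l : StrongDual ℝ (Space n))
    (hl : ∀ y ∈ σ, l y ≤ l p) :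
    localCone p {x | x ∈ σ ∧ ∀ y ∈ σ, l y ≤ l x} =
      {v | v ∈ localCone p σ ∧ ∀ w ∈ localCone p σ, l w ≤ l v} := by
  ext v
  constructor
  · rintro ⟨ε, hε, h, hmax⟩
    refine ⟨⟨ε, hε, h⟩, fun w ⟨δ, hδ, hw⟩ => ?_⟩
    have h1 := hmax p hp
    have h2 := hl _ hw
    simp only [map_add, map_smul, smul_eq_mul, le_add_iff_nonneg_right,
      add_le_iff_nonpos_right] at h1 h2
    exact (nonpos_of_mul_nonpos_right h2 hδ).trans (nonneg_of_mul_nonneg_right h1 hε)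
  · rintro ⟨⟨ε, hε, h⟩, hmax⟩
    refine ⟨ε, hε, h, fun y hy => (hl y hy).trans ?_⟩
    have := hmax 0 (zero_mem_localCone hp)
    rw [map_zero] at this
    rw [map_add, map_smul, smul_eq_mul, le_add_iff_nonneg_right]
    positivity

theorem IsFace.localCone (hρ : IsFace ρ σ) (hpρ : p ∈ ρ) :
    IsFace (localCone p ρ) (localCone p σ) := by
  obtain ⟨l, rfl⟩ := hρ.2 hρ.1
  exact ⟨⟨0, zero_mem_localCone hpρ⟩, fun _ => ⟨l, localCone_setOf_forall_le hpρ.1 l hpρ.2⟩⟩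

theorem exists_isFace_of_isFace_localCone (hp : p ∈ σ) {κ : Set (Space n)}
    (hκ : IsFace κ (localCone p σ)) : ∃ ρ, IsFace ρ σ ∧ p ∈ ρ ∧ localCone p ρ = κ := by
  obtain ⟨l, rfl⟩ := hκ.2 hκ.1
  obtain ⟨v, _, hmax⟩ := hκ.1
  -- a linear form bounded above on a cone is nonpositive there
  have hneg : ∀ w ∈ localCone p σ, l w ≤ 0 := by
    intro w hw
    by_contra! h
    have h1 := hmax _ (smul_mem_localCone hp hw (t := (|l v| + 1) / l w) (by positivity))
    rw [map_smul, smul_eq_mul, div_mul_cancel₀ _ h.ne'] at h1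
    linarith [le_abs_self (l v)]
  have hl : ∀ y ∈ σ, l y ≤ l p := fun y hy => by
    have := hneg _ (sub_mem_localCone (p := p) hy)
    rwa [map_sub, sub_nonpos] at this
  have hpρ : p ∈ {x | x ∈ σ ∧ ∀ y ∈ σ, l y ≤ l x} := ⟨hp, hl⟩
  exact ⟨_, ⟨⟨p, hpρ⟩, fun _ => ⟨l, rfl⟩⟩, hpρ, localCone_setOf_forall_le hp l hl⟩

theorem IsRationalPolyhedron.localCone (hσ : IsRationalPolyhedron σ) (hp : p ∈ σ) :
    IsRationalPolyhedron (localCone p σ) := by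
  classical
  obtain ⟨s, rfl⟩ := hσ.exists_eq_faceOf
  refine ⟨(s.filter fun c => intForm c.1 p = c.2).image fun c => (c.1, 0), ?_⟩
  ext v
  rw [mem_localCone_faceOf hp]
  simp only [Set.mem_ofPred_eq, Finset.forall_mem_image, Finset.mem_filter, and_imp, intForm_apply]

end LocalCone

/-! ### The star of a complex at a point -/

section Star

variable {n d : ℕ}

theorem PolyhedralComplex.subset_of_localCone_subset (C : PolyhedralComplex n d) {p : Space n}
    {σ σ' : Set (Space n)} (hσ : σ ∈ C.cells) (hσ' : σ' ∈ C.cells) (hp : p ∈ σ) (hp' : p ∈ σ')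
    (h : localCone p σ ⊆ localCone p σ') : σ ⊆ σ' := by
  intro y hy
  obtain ⟨ε, hε, hε'⟩ := h (sub_mem_localCone hy)
  have hδ : 0 < min ε 2⁻¹ := lt_min hε (by norm_num)
  have hδ1 : min ε 2⁻¹ < 1 := (min_le_right _ _).trans_lt (by norm_num)
  -- a point of both cells in the open segment from `p` to `y`
  have hmem' : p + min ε 2⁻¹ • (y - p) ∈ σ' :=
    add_smul_mem_of_le (C.rational σ' hσ').convex hp' hδ.le (min_le_left _ _) hε'
  have hmem : p + min ε 2⁻¹ • (y - p) ∈ σ :=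
    (C.rational σ hσ).convex.add_smul_sub_mem hp hy ⟨hδ.le, hδ1.le⟩
  have hseg : p + min ε 2⁻¹ • (y - p) ∈ openSegment ℝ p y := by
    rw [openSegment_eq_image']
    exact ⟨_, ⟨hδ, hδ1⟩, rfl⟩
  exact ((C.inter_face σ hσ σ' hσ' ⟨p, hp, hp'⟩).2.isExtreme.right_mem_of_mem_openSegment hp hy
    ⟨hmem, hmem'⟩ hseg).2

open Classical in
/-- The star of a complex at the point `p`, translated to the origin: its cells are the local cones
at `p` of the cells containing `p`. -/
noncomputable def PolyhedralComplex.star (C : PolyhedralComplex n d) (p : Space n) :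
    PolyhedralComplex n d where
  cells := (C.cells.filter fun σ => p ∈ σ).image (localCone p)
  nonempty := by
    simp only [Finset.mem_image, Finset.mem_filter]
    rintro _ ⟨σ, ⟨_, hp⟩, rfl⟩
    exact ⟨0, zero_mem_localCone hp⟩
  rational := by
    simp only [Finset.mem_image, Finset.mem_filter]
    rintro _ ⟨σ, ⟨hσ, hp⟩, rfl⟩
    exact (C.rational σ hσ).localCone hp
  face_mem := by
    simp only [Finset.mem_image, Finset.mem_filter]
    rintro _ ⟨σ, ⟨hσ, hp⟩, rfl⟩ κ hκ
    obtain ⟨ρ, hρ, hpρ, rfl⟩ := exists_isFace_of_isFace_localCone hp hκ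
    exact ⟨ρ, ⟨C.face_mem σ hσ ρ hρ, hpρ⟩, rfl⟩
  inter_face := by
    simp only [Finset.mem_image, Finset.mem_filter]
    rintro _ ⟨σ, ⟨hσ, hp⟩, rfl⟩ _ ⟨σ', ⟨hσ', hp'⟩, rfl⟩ _
    rw [← localCone_inter (C.rational σ hσ).convex (C.rational σ' hσ').convex hp hp']
    exact (C.inter_face σ hσ σ' hσ' ⟨p, hp, hp'⟩).localCone ⟨hp, hp'⟩
  pure := by
    simp only [Finset.mem_image, Finset.mem_filter]
    rintro _ ⟨τ, ⟨hτ, hp⟩, rfl⟩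
    obtain ⟨σ, hσ, hdim, hsub⟩ := C.pure τ hτ
    refine ⟨_, ⟨σ, ⟨hσ, hsub hp⟩, rfl⟩, by rw [dim_localCone (hsub hp), hdim], ?_⟩
    rintro v ⟨ε, hε, h⟩
    exact ⟨ε, hε, hsub h⟩

open Classical in
theorem PolyhedralComplex.facets_star (C : PolyhedralComplex n d) (p : Space n) :
    (C.star p).facets = (C.facets.filter fun σ => p ∈ σ).image (localCone p) := by
  ext K
  simp only [facets, star, Finset.mem_image, Finset.mem_filter]
  constructor
  · rintro ⟨⟨σ, ⟨hσ, hp⟩, rfl⟩, hdim⟩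
    exact ⟨σ, ⟨⟨hσ, by rwa [dim_localCone hp] at hdim⟩, hp⟩, rfl⟩
  · rintro ⟨σ, ⟨⟨hσ, hdim⟩, hp⟩, rfl⟩
    exact ⟨⟨σ, ⟨hσ, hp⟩, rfl⟩, by rwa [dim_localCone hp]⟩

open Classical in
theorem PolyhedralComplex.facetsAround_star (C : PolyhedralComplex n d) {p : Space n}
    {τ : Set (Space n)} (hτ : τ ∈ C.cells) (hp : p ∈ τ) :
    (C.star p).facetsAround (localCone p τ) = (C.facetsAround τ).image (localCone p) := by
  ext K
  rw [facetsAround, facets_star]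
  simp only [facetsAround, facets, Finset.mem_image, Finset.mem_filter]
  constructor
  · rintro ⟨⟨σ, ⟨⟨hσ, hdim⟩, hpσ⟩, rfl⟩, hsub⟩
    exact ⟨σ, ⟨⟨hσ, hdim⟩, C.subset_of_localCone_subset hτ hσ hp hpσ hsub⟩, rfl⟩
  · rintro ⟨σ, ⟨⟨hσ, hdim⟩, hsub⟩, rfl⟩
    exact ⟨⟨σ, ⟨⟨hσ, hdim⟩, hsub hp⟩, rfl⟩, fun v ⟨ε, hε, h⟩ => ⟨ε, hε, hsub h⟩⟩

theorem PolyhedralComplex.injOn_localCone (C : PolyhedralComplex n d) (p : Space n) :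
    Set.InjOn (localCone p) {σ | σ ∈ C.cells ∧ p ∈ σ} := fun _ h _ h' heq =>
  (C.subset_of_localCone_subset h.1 h'.1 h.2 h'.2 heq.subset).antisymm
    (C.subset_of_localCone_subset h'.1 h.1 h'.2 h.2 heq.superset)

/-- The cell of `C` at `p` with a given local cone. -/
noncomputable def PolyhedralComplex.cellOfCone (C : PolyhedralComplex n d) (p : Space n) :
    Set (Space n) → Set (Space n) :=
  Function.invFunOn (localCone p) {σ | σ ∈ C.cells ∧ p ∈ σ}

theorem PolyhedralComplex.cellOfCone_localCone (C : PolyhedralComplex n d) {p : Space n}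
    {σ : Set (Space n)} (hσ : σ ∈ C.cells) (hp : p ∈ σ) :
    C.cellOfCone p (localCone p σ) = σ :=
  (C.injOn_localCone p).leftInvOn_invFunOn ⟨hσ, hp⟩

theorem PolyhedralComplex.mem_facetsAround {C : PolyhedralComplex n d} {τ σ : Set (Space n)} :
    σ ∈ C.facetsAround τ ↔ σ ∈ C.cells ∧ dim σ = d ∧ τ ⊆ σ := by
  simp [facetsAround, facets, and_assoc]

theorem IsPrimitiveGenerator.localCone {p : Space n} {σ τ : Set (Space n)} (hp : p ∈ τ)
    {v : Space n ⧸ vectorSpan ℝ τ} (hv : IsPrimitiveGenerator σ τ v) :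
    IsPrimitiveGenerator (localCone p σ) (localCone p τ)
      (Submodule.quotEquivOfEq _ _ (vectorSpan_localCone hp).symm v) := by
  obtain ⟨⟨z, hz⟩, hprim, y, hy, x, hx, t, ht, hv⟩ := hv
  refine ⟨⟨z, by rw [hz]; rfl⟩, fun w ⟨u, hu⟩ k hk => ?_, y - p, sub_mem_localCone hy,
    x - p, sub_mem_localCone hx, t, ht, ?_⟩
  · refine hprim ((Submodule.quotEquivOfEq _ _ (vectorSpan_localCone hp).symm).symm w)
      ⟨u, by rw [hu]; rfl⟩ k ?_
    rw [← map_nsmul, ← hk, LinearEquiv.symm_apply_apply]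
  · rw [hv, map_smul, Submodule.quotEquivOfEq_mk, sub_sub_sub_cancel_right]

/-- The star at `p` of a tropical complex, with the weights of the complex multiplied by `c`. The
balancing condition at the local cone of a ridge is that of the ridge. -/
noncomputable def TropicalComplex.star (X : TropicalComplex n d) (p : Space n) (c : ℤ) :
    TropicalComplex n d where
  toPolyhedralComplex := X.toPolyhedralComplex.star p
  weight K := c * X.weight (X.cellOfCone p K)
  balanced := by
    classical
    intro κ hκ hdim
    obtain ⟨τ, hτp, rfl⟩ := Finset.mem_image.1 hκ
    obtain ⟨hτ, hp⟩ := Finset.mem_filter.1 hτp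
    rw [dim_localCone hp] at hdim
    obtain ⟨v, hv, hsum⟩ := X.balanced τ hτ hdim
    have hcell : ∀ σ ∈ X.facetsAround τ, X.cellOfCone p (localCone p σ) = σ := fun σ hσ =>
      X.cellOfCone_localCone (PolyhedralComplex.mem_facetsAround.1 hσ).1
        ((PolyhedralComplex.mem_facetsAround.1 hσ).2.2 hp)
    set e := Submodule.quotEquivOfEq _ _ (vectorSpan_localCone hp).symm
    refine ⟨fun K => e (v (X.cellOfCone p K)), ?_, ?_⟩
    · rw [X.facetsAround_star hτ hp]
      intro K hK
      obtain ⟨σ, hσ, rfl⟩ := Finset.mem_image.1 hK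
      dsimp only
      rw [hcell σ hσ]
      exact (hv σ hσ).localCone hp
    · rw [X.facetsAround_star hτ hp, Finset.sum_image]
      · have hc := congrArg (fun w => c • e w) hsum
        simp only [map_sum, map_zsmul, Finset.smul_sum, map_zero, smul_zero, smul_smul] at hc
        rw [← hc]
        exact Finset.sum_congr rfl fun σ hσ => by
          dsimp only
          rw [hcell σ hσ]
      · intro σ hσ σ' hσ' h
        rw [← hcell σ hσ, h, hcell σ' hσ']

theorem TropicalComplex.isFanCycle_star (X : TropicalComplex n d) (p : Space n) (c : ℤ) :
    IsFanCycle (X.star p c).genericWeight := by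
  classical
  refine ⟨_, rfl, fun x ⟨K, hK, hw, hx⟩ t ht => ⟨K, hK, hw, ?_⟩⟩
  have hK' : K ∈ (X.toPolyhedralComplex.star p).facets := hK
  rw [PolyhedralComplex.facets_star] at hK'
  obtain ⟨σ, hσ, rfl⟩ := Finset.mem_image.1 hK'
  exact smul_mem_localCone (Finset.mem_filter.1 hσ).2 hx ht

open Classical in
theorem TropicalComplex.sum_weight_star (X : TropicalComplex n d) (p : Space n) (c : ℤ)
    (v : Space n) :
    ∑ K ∈ (X.star p c).facets.filter (fun K => v ∈ K), (X.star p c).weight K =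
      ∑ σ ∈ X.facets, X.weight σ * (if p ∈ σ ∧ v ∈ localCone p σ then c else 0) := by
  have hfacets : (X.star p c).facets = (X.facets.filter fun σ => p ∈ σ).image (localCone p) :=
    PolyhedralComplex.facets_star _ p
  have hmem : ∀ σ ∈ X.facets.filter fun σ => p ∈ σ, σ ∈ X.cells ∧ p ∈ σ := fun σ hσ =>
    ⟨(Finset.mem_filter.1 (Finset.mem_filter.1 hσ).1).1, (Finset.mem_filter.1 hσ).2⟩
  rw [Finset.sum_filter, hfacets, Finset.sum_image fun σ hσ σ' hσ' h =>
    X.injOn_localCone p (hmem σ hσ) (hmem σ' hσ') h, Finset.sum_filter]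
  refine Finset.sum_congr rfl fun σ hσ => ?_
  by_cases hp : p ∈ σ
  · have hw : (X.star p c).weight (localCone p σ) = c * X.weight σ := by
      change c * X.weight (X.cellOfCone p (localCone p σ)) = _
      rw [X.cellOfCone_localCone (Finset.mem_filter.1 hσ).1 hp]
    by_cases hv : v ∈ localCone p σ
    · simp [hp, hv, hw, mul_comm]
    · simp [hv]
  · simp [hp]

end Star

/-! ### The decomposition into stars -/

/-- The Brianchon–Gram identities of the facets, weighted and added up: a tropical complex is the
sum of its stars at finitely many points, with integer coefficients that are absorbed into the
weights of the stars. -/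
theorem TropicalComplex.exists_genericWeight_eq_sum_translate_star {n d : ℕ}
    (X : TropicalComplex n d) :
    ∃ (p : Set (Space n) → Space n) (c : Set (Space n) → ℤ),
      X.genericWeight =
        ∑ τ ∈ X.cells, translate (p τ) (X.star (p τ) (c τ)).genericWeight := by
  classical
  obtain ⟨p, c, hpc⟩ := X.exists_indicator_eq_sum_localCone
  refine ⟨p, c, ?_⟩
  let f : Set (Space n) → Space n → ℤ := fun τ x =>
    ∑ K ∈ (X.star (p τ) (c τ)).facets.filter (fun K => x - p τ ∈ K),
      (X.star (p τ) (c τ)).weight K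
  have hf : (fun x => ∑ σ ∈ X.facets.filter (fun σ => x ∈ σ), X.weight σ) =
      ∑ τ ∈ X.cells, f τ := by
    ext x
    simp only [f, Finset.sum_apply, TropicalComplex.sum_weight_star]
    rw [Finset.sum_comm, Finset.sum_filter]
    refine Finset.sum_congr rfl fun σ hσ => ?_
    rw [← Finset.mul_sum, ← hpc σ (Finset.mem_filter.1 hσ).1 x, mul_ite, mul_one, mul_zero]
  have hmk : ∀ τ, translate (p τ) (X.star (p τ) (c τ)).genericWeight =
      (QuotientAddGroup.mk' (negligibleFunctions n d)) (f τ) := fun τ => rfl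
  simp only [hmk]
  rw [← map_sum, ← hf]
  rfl

end Tropical

theorem mainTheorem1 (n d : ℕ) (X : Tropical.GenericWeight n d)
    (hX : Tropical.IsTropicalCycle X) :
    ∃ (l : ℕ) (F : Fin l → Tropical.GenericWeight n d) (p : Fin l → Tropical.Space n),
      (∀ i, Tropical.IsFanCycle (F i)) ∧
      X = ∑ i, Tropical.translate (p i) (F i) := by
  obtain ⟨C, rfl⟩ := hX
  obtain ⟨p, c, h⟩ := C.exists_genericWeight_eq_sum_translate_star
  let e := C.cells.equivFin.symm
  refine ⟨C.cells.card, fun i => (C.star (p (e i)) (c (e i))).genericWeight, fun i => p (e i),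
    fun i => C.isFanCycle_star _ _, ?_⟩
  rw [h, ← Finset.sum_coe_sort]
  exact (e.sum_comp fun τ : C.cells =>
    Tropical.translate (p τ) (C.star (p τ) (c τ)).genericWeight).symm
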